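/- Let $K\subset\mathbb{R}$ be compact, let $r,l,m\in\mathbb{N}$ and $n=r+2l$, and let $\lambda_1,\dots,\lambda_r,\alpha_1,\omega_1,\dots,\alpha_l,\omega_l\in C(K,\mathbb{R})$ and $B=[b_1,\dots,b_m]\in C(K,\mathbb{R}^{n\times m})$ be continuous. Put $$A(\beta)=\operatorname{diag}\{\lambda_1(\beta),\dots,\lambda_r(\beta),G_1(\beta),\dots,G_l(\beta)\},\qquad G_j(\beta)=\begin{bmatrix}\alpha_j(\beta)&-\omega_j(\beta)\\ \omega_j(\beta)&\alpha_j(\beta)\end{bmatrix},$$ and let $A^*(\beta)=A(\beta)^{\mathsf T}=\operatorname{diag}\{\lambda_1(\beta),\dots,\lambda_r(\beta),G_1(\beta)^{\mathsf T},\dots,G_l(\beta)^{\mathsf T}\}$. Consider the ensemble $$\frac{\mathrm d}{\mathrm dt}X(t,\beta)=A(\beta)X(t,\beta)+B(\beta)u(t),\qquad \beta\in K,\quad X(t,\cdot)\in C(K,\mathbb{R}^n),$$ with piecewise constant controls $u:[0,T]\to\mathbb{R}^m$. It is called uniformly ensemble controllable on $C(K,\mathbb{R}^n)$ if for every $\varepsilon>0$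 and all $X_0,X_F\in C(K,\mathbb{R}^n)$ there are a finite time $T>0$ and a piecewise constant control $u:[0,T]\to\mathbb{R}^m$ whose trajectory with $X(0,\cdot)=X_0$ satisfies $\sup_{\beta\in K}\|X(T,\beta)-X_F(\beta)\|<\varepsilon$. Let $\mathcal{K}=\bigcup_j\lambda_j(K)\cup\bigcup_j(\alpha_j+i\omega_j)(K)\cup\bigcup_j(\alpha_j-i\omega_j)(K)\subset\mathbb{C}$, and for $\eta\in\mathcal{K}$ let $$\gamma^{-1}(\eta)=\bigcup_j\lambda_j^{-1}(\eta)\cup\bigcup_j(\alpha_j+i\omega_j)^{-1}(\eta)\cup\bigcup_j(\alpha_j-i\omega_j)^{-1}(\eta)\subset K,$$ with cardinality $\kappa(\eta)$. Suppose that $$\mathcal{L}=\operatorname{span}_{\mathbb{R}}\{A^kb_j:\ 1\le j\le m,\ k\in\mathbb{N}\}\subset C(K,\mathbb{R}^n),\qquad \mathbb{N}=\{0,1,2,\dots\},$$ is closed under left multiplication by $A^*$, i.e. $A^*f\in\mathcal{L}$ for every $f\in\mathcal{L}$. Then: 1. The ensemble is uniformly ensemble controllable on $C(K,\mathbb{R}^n)$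 if and only if for every $\eta\in\mathcal{K}$ the system with state $Y=(Y_\beta)_{\beta\in\gamma^{-1}(\eta)}$, $Y_\beta\in\mathbb{R}^n$, given by $$\frac{\mathrm d}{\mathrm dt}Y_\beta(t)=A(\beta)Y_\beta(t)+B(\beta)u(t),\qquad \beta\in\gamma^{-1}(\eta),$$ is controllable on $(\mathbb{R}^n)^{\gamma^{-1}(\eta)}$ (which is $\mathbb{R}^{n\kappa(\eta)}$ when $\kappa(\eta)<\infty$), i.e. any state can be steered exactly to any other state in some finite time $T>0$ by a piecewise constant control. 2. If all the functions $\lambda_j$ and $\alpha_j\pm i\omega_j$ are finite-to-one (the preimage of each of their values is finite), so that $\gamma^{-1}(\eta)=\{\beta_1,\dots,\beta_{\kappa(\eta)}\}$ is finite for every $\eta\in\mathcal{K}$, then the ensemble is uniformly ensemble controllable on $C(K,\mathbb{R}^n)$ if and only if for every $\eta\in\mathcal{K}$ the matrix $$G(\eta)=\begin{bmatrix}B(\beta_1)&A(\beta_1)B(\beta_1)&\cdots&A(\beta_1)^{n\kappa(\eta)-1}B(\beta_1)\\ \vdots&\vdots&&\vdots\\ B(\beta_{\kappa(\eta)})&A(\beta_{\kappa(\eta)})B(\beta_{\kappa(\eta)})&\cdots&A(\beta_{\kappa(\eta)})^{n\kappa(\eta)-1}B(\beta_{\kappa(\eta)})\end{bmatrix}\in\mathbb{R}^{n\kappa(\eta)\times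 mn\kappa(\eta)}$$ has full row rank $n\kappa(\eta)$. -/

import Mathlib

open scoped Matrix

namespace EnsembleControl

noncomputable section

/-! ### Control systems -/

/-- `u` is piecewise constant on `[0, T]`: it is constant on each open interval of a finite
partition `0 = t₀ < t₁ < ⋯ < t_N = T`. -/
def PiecewiseConstant {V : Type*} (T : ℝ) (u : ℝ → V) : Prop :=
  ∃ (N : ℕ) (t : Fin (N + 1) → ℝ), StrictMono t ∧ t 0 = 0 ∧ t (Fin.last N) = T ∧
    ∀ i : Fin N, ∃ c : V, ∀ s ∈ Set.Ioo (t i.castSucc) (t i.succ), u s = c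

/-- `X : [0, T] → E` is a trajectory of `dX/dt = F X + G u`: it is continuous on `[0, T]` and
satisfies the differential equation except at finitely many (switching) times.
The derivative is taken in the topological vector space `E`. -/
def IsTrajectory {E V : Type*} [AddCommGroup E] [Module ℝ E] [TopologicalSpace E]
    [ContinuousSMul ℝ E] (F : E → E) (G : V → E) (T : ℝ) (u : ℝ → V) (X : ℝ → E) : Prop :=
  ContinuousOn X (Set.Icc 0 T) ∧
    ∃ S : Finset ℝ, ∀ t ∈ Set.Ioo 0 T, t ∉ S → HasDerivAt X (F (X t) + G (u t)) t

/-- Controllability of `dX/dt = F X + G u` on `E`: any state can be steered to any other state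
in finite time by a piecewise constant control. -/
def IsControllable {E V : Type*} [AddCommGroup E] [Module ℝ E] [TopologicalSpace E]
    [ContinuousSMul ℝ E] (F : E → E) (G : V → E) : Prop :=
  ∀ X₀ X₁ : E, ∃ T : ℝ, 0 < T ∧ ∃ u : ℝ → V, PiecewiseConstant T u ∧
    ∃ X : ℝ → E, IsTrajectory F G T u X ∧ X 0 = X₀ ∧ X T = X₁

/-- Controllability of `dX/dt = F X + G u` up to arbitrarily small errors in the norm of `E`. -/
def IsApproxControllable {E V : Type*} [NormedAddCommGroup E] [NormedSpace ℝ E]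
    (F : E → E) (G : V → E) : Prop :=
  ∀ ε : ℝ, 0 < ε → ∀ X₀ X₁ : E, ∃ T : ℝ, 0 < T ∧ ∃ u : ℝ → V, PiecewiseConstant T u ∧
    ∃ X : ℝ → E, IsTrajectory F G T u X ∧ X 0 = X₀ ∧ ‖X T - X₁‖ < ε

/-! ### Linear ensembles -/

/-- The function `β ↦ M(β) f(β)`. -/
def mulVecC {K ι κ : Type*} [TopologicalSpace K] [Fintype κ]
    (M : C(K, Matrix ι κ ℝ)) (f : C(K, κ → ℝ)) : C(K, ι → ℝ) :=
  ⟨fun β => M β *ᵥ f β, M.continuous.matrix_mulVec f.continuous⟩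

/-- The function `b_j ∈ C(K, ℝⁿ)`, the `j`-th column of `B ∈ C(K, ℝ^{n × m})`. -/
def columnC {K ι κ : Type*} [TopologicalSpace K]
    (B : C(K, Matrix ι κ ℝ)) (j : κ) : C(K, ι → ℝ) :=
  ⟨fun β i => B β i j, continuous_pi fun i => B.continuous.matrix_elem i j⟩

/-- Uniform ensemble controllability on `C(K, ℝⁿ)`, with the sup-norm, of the ensemble
`dX/dt(t, β) = A(β) X(t, β) + B(β) u(t)`, `β ∈ K`. -/
def UniformlyEnsembleControllable {K ι κ : Type*} [TopologicalSpace K] [CompactSpace K]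
    [Fintype ι] [Fintype κ] (A : C(K, Matrix ι ι ℝ)) (B : C(K, Matrix ι κ ℝ)) : Prop :=
  IsApproxControllable (E := C(K, ι → ℝ)) (V := κ → ℝ)
    (fun X => mulVecC A X) (fun u => mulVecC B (ContinuousMap.const K u))

/-- `𝓛 = span_ℝ {A^k b_j : j, k ∈ ℕ}`. -/
def reachableSpan {K ι κ : Type*} [TopologicalSpace K] [Fintype ι] [DecidableEq ι]
    (A : C(K, Matrix ι ι ℝ)) (B : C(K, Matrix ι κ ℝ)) : Submodule ℝ C(K, ι → ℝ) :=
  Submodule.span ℝ {f | ∃ (j : κ) (k : ℕ), f = mulVecC (A ^ k) (columnC B j)}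

/-! ### The subsystem of the ensemble indexed by a set of parameters -/

/-- The operator `𝒟_M(S) = diag (M(β) : β ∈ S)` on `(ℝⁿ)^S`. -/
def stackDiag {K ι : Type*} [Fintype ι] (M : K → Matrix ι ι ℝ) (S : Set K)
    (y : S → ι → ℝ) : S → ι → ℝ :=
  fun β => M β *ᵥ y β

/-- The operator `𝒱_M(S) : ℝᵐ → (ℝⁿ)^S` that stacks the matrices `M(β)`, `β ∈ S`. -/
def stackCol {K ι κ : Type*} [Fintype κ] (M : K → Matrix ι κ ℝ) (S : Set K)
    (v : κ → ℝ) : S → ι → ℝ :=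
  fun β => M β *ᵥ v

/-- Controllability on `(ℝⁿ)^S` of the system `dY/dt = 𝒟_A(S) Y + 𝒱_B(S) u`. -/
def SubsystemControllable {K ι κ : Type*} [Fintype ι] [Fintype κ]
    (A : K → Matrix ι ι ℝ) (B : K → Matrix ι κ ℝ) (S : Set K) : Prop :=
  IsControllable (E := S → ι → ℝ) (V := κ → ℝ) (stackDiag A S) (stackCol B S)

/-- The matrix `[𝒱_B(S), 𝒟_A(S) 𝒱_B(S), …, 𝒟_A(S)^{np-1} 𝒱_B(S)]`, where `S` has `p` elements:
its row block indexed by `β ∈ S` is `[B(β), A(β) B(β), …, A(β)^{np-1} B(β)]`. -/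
def ensembleControllabilityMatrix {K ι κ : Type*} [Fintype ι] [DecidableEq ι]
    (A : K → Matrix ι ι ℝ) (B : K → Matrix ι κ ℝ) (S : Set K) :
    Matrix (S × ι) (Fin (Fintype.card ι * S.ncard) × κ) ℝ :=
  Matrix.of fun p q => (A p.1 ^ (q.1 : ℕ) * B p.1) p.2 q.2

/-! ### Drift in real Jordan form -/

/-- The coordinates of `ℝⁿ`, `n = r + 2 l`: `r` scalar ones and `l` pairs. -/
abbrev Coord (r l : ℕ) : Type := Fin r ⊕ (Fin 2 × Fin l)

/-- `diag(λ_1, …, λ_r, G_1, …, G_l)` with `G_j = [[α_j, -ω_j], [ω_j, α_j]]`. -/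
def jordanDrift {K : Type*} [TopologicalSpace K] {r l : ℕ}
    (lam : Fin r → C(K, ℝ)) (α ω : Fin l → C(K, ℝ)) :
    C(K, Matrix (Coord r l) (Coord r l) ℝ) where
  toFun β := Matrix.fromBlocks (Matrix.diagonal fun j => lam j β) 0 0
    (Matrix.blockDiagonal fun j => !![α j β, -ω j β; ω j β, α j β])
  continuous_toFun := by
    refine Continuous.matrix_fromBlocks (by fun_prop) continuous_const continuous_const ?_
    refine Continuous.matrix_blockDiagonal (continuous_pi fun j => continuous_matrix ?_)
    intro i k
    fin_cases i <;> fin_cases k <;> simp <;> fun_prop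

/-- `A* = diag(λ_1, …, λ_r, G_1*, …, G_l*)` with `G_j* = [[α_j, ω_j], [-ω_j, α_j]]`. -/
def jordanDriftStar {K : Type*} [TopologicalSpace K] {r l : ℕ}
    (lam : Fin r → C(K, ℝ)) (α ω : Fin l → C(K, ℝ)) :
    C(K, Matrix (Coord r l) (Coord r l) ℝ) where
  toFun β := Matrix.fromBlocks (Matrix.diagonal fun j => lam j β) 0 0
    (Matrix.blockDiagonal fun j => !![α j β, ω j β; -ω j β, α j β])
  continuous_toFun := by
    refine Continuous.matrix_fromBlocks (by fun_prop) continuous_const continuous_const ?_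
    refine Continuous.matrix_blockDiagonal (continuous_pi fun j => continuous_matrix ?_)
    intro i k
    fin_cases i <;> fin_cases k <;> simp <;> fun_prop

/-- The eigenvalue function `λ_j`, with values in `ℂ`. -/
def realEig {K : Type*} [TopologicalSpace K] (lam : C(K, ℝ)) : K → ℂ :=
  fun β => (lam β : ℂ)

/-- The eigenvalue function `α_j + i ω_j`. -/
def eigPlus {K : Type*} [TopologicalSpace K] (α ω : C(K, ℝ)) : K → ℂ :=
  fun β => (α β : ℂ) + Complex.I * (ω β : ℂ)

/-- The eigenvalue function `α_j - i ω_j`. -/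
def eigMinus {K : Type*} [TopologicalSpace K] (α ω : C(K, ℝ)) : K → ℂ :=
  fun β => (α β : ℂ) - Complex.I * (ω β : ℂ)

/-- The set `𝒦 ⊆ ℂ` of all eigenvalues of all `A(β)`, `β ∈ K`. -/
def eigenvalueSet {K : Type*} [TopologicalSpace K] {r l : ℕ}
    (lam : Fin r → C(K, ℝ)) (α ω : Fin l → C(K, ℝ)) : Set ℂ :=
  (⋃ j, Set.range (realEig (lam j))) ∪ (⋃ j, Set.range (eigPlus (α j) (ω j))) ∪
    (⋃ j, Set.range (eigMinus (α j) (ω j)))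

/-- `γ⁻¹(η) ⊆ K`: the parameters `β` at which one of the eigenvalue functions equals `η`. -/
def eigenvalueFiber {K : Type*} [TopologicalSpace K] {r l : ℕ}
    (lam : Fin r → C(K, ℝ)) (α ω : Fin l → C(K, ℝ)) (η : ℂ) : Set K :=
  (⋃ j, realEig (lam j) ⁻¹' {η}) ∪ (⋃ j, eigPlus (α j) (ω j) ⁻¹' {η}) ∪
    (⋃ j, eigMinus (α j) (ω j) ⁻¹' {η})

/-- Every value of `f` has a finite preimage. -/
def FiniteToOne {K : Type*} (f : K → ℂ) : Prop :=
  ∀ η ∈ Set.range f, (f ⁻¹' {η}).Finite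

end

end EnsembleControl

open EnsembleControl

/-!
# Uniform ensemble controllability and controllability on the eigenvalue fibres

Write `𝓛` for the span of the functions `Aᵏ b_j`. For a linear system `X' = A X + B u` with bounded
drift on a Banach space, the states that can be reached from `0` lie in the closure of the Krylov
space `span {Aᵏ B v}`, and they are dense in it. Hence approximate controllability means that the
Krylov space is dense, and in finite dimension exact controllability means that it is everything
(`isApproxControllable_iff`, `isControllable_iff`). For the ensemble the Krylov space is `𝓛`; for
the subsystem indexed by a finite `S ⊆ K` it is the space of restrictions of `𝓛` to `S`.

The eigenvalue fibres are finite under either side of the equivalence. On the set where one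
eigenvalue function is constant, the corresponding components of all `Aᵏ b_j` are combinations of
the finitely many entries of `B`, so they cannot interpolate arbitrary values on many points
(`finite_eigenvalueFiber`). A dense `𝓛` restricts onto everything on a finite set, so every fibre
subsystem is controllable.

Conversely, if `A* 𝓛 ⊆ 𝓛`, then `𝓛` is stable under `A + A*` and `A A*`. Both are real diagonal
matrices, with entries `2 Re μ` and `|μ|²` for the eigenvalues `μ` of `A`; together they determine
`μ` up to conjugation. A Stone–Weierstrass theorem for submodules
(`topologicalClosure_eq_top_of_fiberwise`) shows that `𝓛` is dense as soon as it interpolates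
arbitrary functions on each set where `μ` is constant up to conjugation, and such a set lies over
one fibre `γ⁻¹(η)` (`dense_of_subsystemKrylov_eq_top`).

On finite fibres the rank condition is Kalman's criterion, the powers of `A` beyond the dimension
being redundant by the Cayley–Hamilton theorem (`rank_ensembleControllabilityMatrix_iff`).
-/

open scoped Matrix

namespace EnsembleControl

/-! ### Piecewise constant controls and trajectories -/

/-- `u` is constant on every closed subinterval of `(0, T)` that avoids a certain finite set.
Unlike the description by an ordered partition, this one is visibly stable under sums. -/
def ConstantOffFinite {V : Type*} (T : ℝ) (u : ℝ → V) : Prop :=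
  ∃ F : Finset ℝ, ∀ a b, 0 < a → a ≤ b → b < T → (∀ x ∈ F, x ∉ Set.Icc a b) → u a = u b

lemma ConstantOffFinite.piecewiseConstant {V : Type*} {T : ℝ} (hT : 0 < T) {u : ℝ → V}
    (hu : ConstantOffFinite T u) : PiecewiseConstant T u := by
  classical
  obtain ⟨F, hF⟩ := hu
  set F' : Finset ℝ := insert 0 (insert T (F.filter fun x => x ∈ Set.Ioo 0 T)) with hF'
  have h0 : (0 : ℝ) ∈ F' := by simp [hF']
  have hT' : T ∈ F' := by simp [hF']
  have hb : ∀ x ∈ F', 0 ≤ x ∧ x ≤ T := by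
    intro x hx
    simp only [hF', Finset.mem_insert, Finset.mem_filter, Set.mem_Ioo] at hx
    rcases hx with rfl | rfl | ⟨-, h1, h2⟩
    · exact ⟨le_rfl, hT.le⟩
    · exact ⟨hT.le, le_rfl⟩
    · exact ⟨h1.le, h2.le⟩
  obtain ⟨N, hN⟩ : ∃ N, F'.card = N + 1 :=
    Nat.exists_eq_succ_of_ne_zero (Finset.card_ne_zero_of_mem h0)
  let e := F'.orderEmbOfFin hN
  have he : ∀ x ∈ F', ∃ i, e i = x := fun x hx => by
    have : x ∈ Set.range e := by rw [Finset.range_orderEmbOfFin]; exact hx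
    exact this
  have hmem : ∀ i, e i ∈ F' := fun i => Finset.orderEmbOfFin_mem F' hN i
  refine ⟨N, e, e.strictMono, ?_, ?_, ?_⟩
  · obtain ⟨i, hi⟩ := he 0 h0
    exact le_antisymm (hi ▸ e.monotone (Fin.zero_le i)) (hb _ (hmem 0)).1
  · obtain ⟨i, hi⟩ := he T hT'
    exact le_antisymm (hb _ (hmem _)).2 (hi ▸ e.monotone (Fin.le_last i))
  · intro i
    -- consecutive points of the partition have no exceptional point between them
    have hgap : ∀ x ∈ F', x ∉ Set.Ioo (e i.castSucc) (e i.succ) := by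
      rintro x hx ⟨h1, h2⟩
      obtain ⟨j, rfl⟩ := he x hx
      have h1' := e.lt_iff_lt.1 h1
      have h2' := e.lt_iff_lt.1 h2
      simp only [Fin.lt_def, Fin.val_castSucc, Fin.val_succ] at h1' h2'
      omega
    have hl := (hb _ (hmem i.castSucc)).1
    have hr := (hb _ (hmem i.succ)).2
    have key : ∀ a b, a ≤ b → a ∈ Set.Ioo (e i.castSucc) (e i.succ) →
        b ∈ Set.Ioo (e i.castSucc) (e i.succ) → u a = u b := by
      intro a b hab ha hb'
      refine hF a b (hl.trans_lt ha.1) hab (hb'.2.trans_le hr) fun x hx hxab => ?_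
      refine hgap x ?_ ⟨ha.1.trans_le hxab.1, hxab.2.trans_lt hb'.2⟩
      simp only [hF', Finset.mem_insert, Finset.mem_filter, Set.mem_Ioo]
      exact Or.inr (Or.inr ⟨hx, hl.trans_lt (ha.1.trans_le hxab.1),
        (hxab.2.trans_lt hb'.2).trans_le hr⟩)
    have hlt : e i.castSucc < e i.succ := e.strictMono (Fin.castSucc_lt_succ)
    refine ⟨u ((e i.castSucc + e i.succ) / 2), fun s hs => ?_⟩
    have hm : (e i.castSucc + e i.succ) / 2 ∈ Set.Ioo (e i.castSucc) (e i.succ) :=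
      ⟨by linarith, by linarith⟩
    rcases le_total s ((e i.castSucc + e i.succ) / 2) with h | h
    · exact key _ _ h hs hm
    · exact (key _ _ h hm hs).symm

/-- A continuous linear map intertwining two control systems sends trajectories to trajectories. -/
lemma IsTrajectory.map {E E' V : Type*} [AddCommGroup E] [Module ℝ E] [TopologicalSpace E]
    [ContinuousSMul ℝ E] [AddCommGroup E'] [Module ℝ E'] [TopologicalSpace E']
    [ContinuousSMul ℝ E'] {F : E → E} {G : V → E} {F' : E' → E'} {G' : V → E'} {T : ℝ}
    {u : ℝ → V} {X : ℝ → E} (p : E →L[ℝ] E') (hF : ∀ x, p (F x) = F' (p x))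
    (hG : ∀ v, p (G v) = G' v) (h : IsTrajectory F G T u X) :
    IsTrajectory F' G' T u (fun t => p (X t)) := by
  obtain ⟨hc, S, hS⟩ := h
  refine ⟨p.continuous.comp_continuousOn hc, S, fun t ht htS => ?_⟩
  have hd := hS t ht htS
  have hval : F' (p (X t)) + G' (u t) = p (F (X t) + G (u t)) := by rw [map_add, hF, hG]
  rw [hval]
  -- the chain rule for a linear outer map, valid without norms on the state spaces
  refine .of_isLittleOTVS <| ((p.isBigOTVS_comp).trans_isLittleOTVS hd.isLittleOTVS).congr_left ?_
  intro q
  simp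

lemma IsControllable.map {E E' V : Type*} [AddCommGroup E] [Module ℝ E] [TopologicalSpace E]
    [ContinuousSMul ℝ E] [AddCommGroup E'] [Module ℝ E'] [TopologicalSpace E']
    [ContinuousSMul ℝ E'] {F : E → E} {G : V → E} {F' : E' → E'} {G' : V → E'}
    (p : E →L[ℝ] E') (hp : Function.Surjective p) (hF : ∀ x, p (F x) = F' (p x))
    (hG : ∀ v, p (G v) = G' v) (h : IsControllable F G) : IsControllable F' G' := by
  intro Y₀ Y₁
  obtain ⟨X₀, rfl⟩ := hp Y₀
  obtain ⟨X₁, rfl⟩ := hp Y₁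
  obtain ⟨T, hT, u, hu, X, hX, h0, h1⟩ := h X₀ X₁
  exact ⟨T, hT, u, hu, fun t => p (X t), hX.map p hF hG, by simp [h0], by simp [h1]⟩

/-! ### Linear control systems with bounded drift on a Banach space -/

section Banach

variable {E V : Type*} [NormedAddCommGroup E] [NormedSpace ℝ E] [AddCommGroup V] [Module ℝ V]

/-- The span of the vectors `Aᵏ B v`. -/
def krylov (A : E →L[ℝ] E) (B : V →ₗ[ℝ] E) : Submodule ℝ E :=
  Submodule.span ℝ {x | ∃ (k : ℕ) (v : V), x = (A ^ k) (B v)}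

lemma pow_apply_mem_krylov (A : E →L[ℝ] E) (B : V →ₗ[ℝ] E) (k : ℕ) (v : V) :
    (A ^ k) (B v) ∈ krylov A B := Submodule.subset_span ⟨k, v, rfl⟩

lemma IsTrajectory.add {A : E →L[ℝ] E} {B : V →ₗ[ℝ] E} {T : ℝ} {u v : ℝ → V} {X Y : ℝ → E}
    (hX : IsTrajectory A B T u X) (hY : IsTrajectory A B T v Y) :
    IsTrajectory A B T (u + v) (X + Y) := by
  classical
  obtain ⟨hXc, S, hX⟩ := hX
  obtain ⟨hYc, S', hY⟩ := hY
  refine ⟨hXc.add hYc, S ∪ S', fun t ht htS => ?_⟩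
  simp only [Finset.mem_union, not_or] at htS
  convert (hX t ht htS.1).add (hY t ht htS.2) using 1
  simp only [Pi.add_apply, map_add]
  abel

/-- The states that can be reached from `0` at time `1`. -/
def reachable (A : E →L[ℝ] E) (B : V →ₗ[ℝ] E) : Submodule ℝ E where
  carrier := {x | ∃ u, ConstantOffFinite 1 u ∧ ∃ X, IsTrajectory A B 1 u X ∧ X 0 = 0 ∧ X 1 = x}
  zero_mem' := ⟨0, ⟨∅, fun _ _ _ _ _ _ => rfl⟩, 0,
    ⟨continuousOn_const, ∅, fun t _ _ => by simp⟩, rfl, rfl⟩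
  add_mem' := by
    classical
    rintro x y ⟨u, ⟨F, hF⟩, X, hX, hX0, hX1⟩ ⟨v, ⟨G, hG⟩, Y, hY, hY0, hY1⟩
    refine ⟨u + v, ⟨F ∪ G, fun a b h0 hab hb h => ?_⟩, X + Y, hX.add hY, ?_, ?_⟩
    · simp only [Pi.add_apply]
      rw [hF a b h0 hab hb fun x hx => h x (Finset.mem_union_left _ hx),
        hG a b h0 hab hb fun x hx => h x (Finset.mem_union_right _ hx)]
    · simp [hX0, hY0]
    · simp [hX1, hY1]
  smul_mem' := by
    rintro c x ⟨u, ⟨F, hF⟩, X, ⟨hXc, S, hX⟩, hX0, hX1⟩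
    refine ⟨c • u, ⟨F, fun a b h0 hab hb h => ?_⟩, c • X, ⟨hXc.const_smul c, S, ?_⟩, ?_, ?_⟩
    · simp only [Pi.smul_apply]
      rw [hF a b h0 hab hb h]
    · intro t ht htS
      convert (hX t ht htS).const_smul c using 1
      simp
    · simp [hX0]
    · simp [hX1]

lemma hasDerivAt_mem_of_isClosed {N : Submodule ℝ E} (hN : IsClosed (N : Set E)) {g : ℝ → E}
    {g' : E} {t : ℝ} (hg : HasDerivAt g g' t) (hmem : ∀ᶠ s in nhds t, g s ∈ N) : g' ∈ N := by
  have h := hasDerivAt_iff_tendsto_slope.1 hg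
  refine hN.mem_of_tendsto h ?_
  filter_upwards [hmem.filter_mono nhdsWithin_le_nhds] with s hs
  rw [slope_def_module]
  exact N.smul_mem _ (N.sub_mem hs hmem.self_of_nhds)

variable [CompleteSpace E]

lemma hasDerivAt_exp_smul_apply (A : E →L[ℝ] E) (x : E) (t : ℝ) :
    HasDerivAt (fun t : ℝ => NormedSpace.exp (t • A) x) (A (NormedSpace.exp (t • A) x)) t := by
  have h := (hasDerivAt_exp_smul_const' A t (𝕂 := ℝ))
  exact ((ContinuousLinearMap.apply ℝ E x).hasFDerivAt.comp_hasDerivAt t h)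

/-- The response at time `t` to a control that is constantly `v` from time `0` on. -/
noncomputable def stepResponse (A : E →L[ℝ] E) (b : E) (t : ℝ) : E :=
  ∫ s in (0 : ℝ)..t, NormedSpace.exp (s • A) b


lemma hasDerivAt_stepResponse (A : E →L[ℝ] E) (b : E) (t : ℝ) :
    HasDerivAt (stepResponse A b) (NormedSpace.exp (t • A) b) t := by
  have hc : Continuous fun s : ℝ => NormedSpace.exp (s • A) b :=
    continuous_iff_continuousAt.2 fun s => (hasDerivAt_exp_smul_apply A b s).continuousAt
  exact intervalIntegral.integral_hasDerivAt_right (hc.intervalIntegrable _ _)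
    hc.aestronglyMeasurable.stronglyMeasurableAtFilter hc.continuousAt

lemma apply_stepResponse_add (A : E →L[ℝ] E) (b : E) (t : ℝ) :
    A (stepResponse A b t) + b = NormedSpace.exp (t • A) b := by
  have hc : Continuous fun s : ℝ => NormedSpace.exp (s • A) b :=
    continuous_iff_continuousAt.2 fun s => (hasDerivAt_exp_smul_apply A b s).continuousAt
  have h1 : A (stepResponse A b t) = ∫ s in (0 : ℝ)..t, A (NormedSpace.exp (s • A) b) :=
    (A.intervalIntegral_comp_comm (hc.intervalIntegrable _ _)).symm
  have h2 := intervalIntegral.integral_eq_sub_of_hasDerivAt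
    (fun s _ => hasDerivAt_exp_smul_apply A b s) ((A.continuous.comp hc).intervalIntegrable 0 t)
  rw [h1, h2]
  simp [NormedSpace.exp_zero]

/-- The state at time `1` when the control is `0` up to time `1 - τ` and `v` afterwards. -/
lemma stepResponse_mem_reachable (A : E →L[ℝ] E) (B : V →ₗ[ℝ] E) (v : V) {τ : ℝ}
    (hτ : τ ∈ Set.Ioo (0 : ℝ) 1) : stepResponse A (B v) τ ∈ reachable A B := by
  have hcont : Continuous (stepResponse A (B v)) :=
    continuous_iff_continuousAt.2 fun s => (hasDerivAt_stepResponse A (B v) s).continuousAt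
  have hzero : stepResponse A (B v) 0 = 0 := by simp [stepResponse]
  refine ⟨fun s => if s < 1 - τ then 0 else v, ⟨{1 - τ}, fun a b _ hab _ h => ?_⟩,
    fun t => stepResponse A (B v) (max (t - (1 - τ)) 0),
    ⟨(hcont.comp (by fun_prop)).continuousOn, {1 - τ}, fun t _ htS => ?_⟩, ?_, ?_⟩
  · have := h _ (Finset.mem_singleton_self _)
    simp only [Set.mem_Icc, not_and_or, not_le] at this
    rcases this with h | h
    · simp [not_lt.2 h.le, not_lt.2 (h.le.trans hab)]
    · simp [h, hab.trans_lt h]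
  · rcases lt_or_gt_of_ne (show t ≠ 1 - τ by simpa using htS) with h | h
    · have : (fun t => stepResponse A (B v) (max (t - (1 - τ)) 0)) =ᶠ[nhds t] fun _ => 0 := by
        filter_upwards [gt_mem_nhds h] with s hs
        rw [max_eq_right (by linarith), hzero]
      simpa [h, max_eq_right (show t - (1 - τ) ≤ 0 by linarith), hzero] using
        (hasDerivAt_const t (0 : E)).congr_of_eventuallyEq this
    · have : (fun t => stepResponse A (B v) (max (t - (1 - τ)) 0)) =ᶠ[nhds t]
          fun t => stepResponse A (B v) (t - (1 - τ)) := by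
        filter_upwards [lt_mem_nhds h] with s hs
        rw [max_eq_left (by linarith)]
      have hd := (hasDerivAt_stepResponse A (B v) (t - (1 - τ))).comp_sub_const t (1 - τ)
      rw [← apply_stepResponse_add] at hd
      simpa [not_lt.2 h.le, max_eq_left (show 0 ≤ t - (1 - τ) by linarith)] using
        hd.congr_of_eventuallyEq this
  · simp only [max_eq_right (show (0 : ℝ) - (1 - τ) ≤ 0 by linarith [hτ.2]), hzero]
  · simp [hτ.1.le]

/-- Differentiating the step responses repeatedly at time `0⁺` produces the vectors `Aᵏ B v`, and
derivatives of curves in a closed subspace stay in it. -/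
lemma krylov_le_closure_reachable (A : E →L[ℝ] E) (B : V →ₗ[ℝ] E) :
    krylov A B ≤ (reachable A B).topologicalClosure := by
  refine Submodule.span_le.2 ?_
  rintro _ ⟨k, v, rfl⟩
  have hN := (reachable A B).isClosed_topologicalClosure
  have key : ∀ k : ℕ, ∀ τ ∈ Set.Ioo (0 : ℝ) 1,
      (A ^ k) (NormedSpace.exp (τ • A) (B v)) ∈ (reachable A B).topologicalClosure := by
    intro k
    induction k with
    | zero =>
      intro τ hτ
      refine hasDerivAt_mem_of_isClosed hN (hasDerivAt_stepResponse A (B v) τ) ?_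
      filter_upwards [isOpen_Ioo.mem_nhds hτ] with s hs
      exact Submodule.le_topologicalClosure _ (stepResponse_mem_reachable A B v hs)
    | succ k ih =>
      intro τ hτ
      have hd := (A ^ k).hasFDerivAt.comp_hasDerivAt τ (hasDerivAt_exp_smul_apply A (B v) τ)
      rw [pow_succ]
      refine hasDerivAt_mem_of_isClosed hN hd ?_
      filter_upwards [isOpen_Ioo.mem_nhds hτ] with s hs
      exact ih s hs
  have hlim : Filter.Tendsto (fun τ : ℝ => (A ^ k) (NormedSpace.exp (τ • A) (B v)))
      (nhdsWithin 0 (Set.Ioi 0)) (nhds ((A ^ k) (B v))) := by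
    have h := ((A ^ k).continuous.continuousAt.comp
      (hasDerivAt_exp_smul_apply A (B v) 0).continuousAt).tendsto
    simp only [Function.comp_apply, zero_smul, NormedSpace.exp_zero,
      one_apply_eq_self] at h
    exact h.mono_left nhdsWithin_le_nhds
  refine hN.mem_of_tendsto hlim ?_
  filter_upwards [Ioo_mem_nhdsGT (zero_lt_one' ℝ)] with τ hτ
  exact key k τ hτ

/-- Every state steered to from `0` lies in the closure of the Krylov space: modulo this closed
invariant subspace `t ↦ exp ((T - t) A) X(t)` has derivative zero. -/
lemma IsTrajectory.mem_closure_krylov {A : E →L[ℝ] E} {B : V →ₗ[ℝ] E} {T : ℝ} (hT : 0 ≤ T)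
    {u : ℝ → V} {X : ℝ → E} (hX : IsTrajectory A B T u X) (h0 : X 0 = 0) :
    X T ∈ (krylov A B).topologicalClosure := by
  set N := (krylov A B).topologicalClosure with hNdef
  have hN : IsClosed (N : Set E) := Submodule.isClosed_topologicalClosure _
  have hexp : ∀ (s : ℝ) (v : V), NormedSpace.exp (s • A) (B v) ∈ N := by
    intro s v
    have hs := (NormedSpace.exp_series_hasSum_exp' (𝕂 := ℝ) (s • A)).mapL
      (ContinuousLinearMap.apply ℝ E (B v))
    refine hN.mem_of_tendsto hs (Filter.Eventually.of_forall fun F => N.sum_mem fun k _ => ?_)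
    simp only [smul_pow, map_smul]
    exact N.smul_mem _ (N.smul_mem _
      (Submodule.le_topologicalClosure _ (pow_apply_mem_krylov A B k v)))
  have : IsClosed (N : Set E) := hN
  rw [← Submodule.Quotient.mk_eq_zero]
  set p : E →L[ℝ] E ⧸ N := N.mkQL
  have hp : ∀ y ∈ N, p y = 0 := fun y hy => (Submodule.Quotient.mk_eq_zero N).2 hy
  change p (X T) = 0
  obtain ⟨hXc, S, hXd⟩ := hX
  have hE : ∀ t, HasDerivAt (fun t : ℝ => NormedSpace.exp ((T - t) • A))
      (-(NormedSpace.exp ((T - t) • A) * A)) t := by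
    intro t
    exact (hasDerivAt_exp_smul_const (𝕂 := ℝ) A (T - t)).comp_const_sub T t
  have hEc : Continuous fun t : ℝ => NormedSpace.exp ((T - t) • A) :=
    continuous_iff_continuousAt.2 fun t => (hE t).continuousAt
  have hint := MeasureTheory.integral_eq_of_hasDerivAt_off_countable_of_le
    (fun t => p (NormedSpace.exp ((T - t) • A) (X t))) (fun _ => 0) hT S.countable_toSet
    (p.continuous.comp_continuousOn (hEc.continuousOn.clm_apply hXc)) ?_ (by simp)
  · simp [h0, NormedSpace.exp_zero] at hint
    exact hint.symm
  · rintro t ⟨ht, htS⟩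
    have hd := p.hasFDerivAt.comp_hasDerivAt t ((hE t).clm_apply (hXd t ht htS))
    have hval : p ((-(NormedSpace.exp ((T - t) • A) * A)) (X t) +
        (NormedSpace.exp ((T - t) • A)) (A (X t) + B (u t))) = 0 := by
      convert hp _ (hexp (T - t) (u t)) using 2
      simp
    rw [hval] at hd
    exact hd

lemma isTrajectory_exp (A : E →L[ℝ] E) (B : V →ₗ[ℝ] E) (T : ℝ) (x : E) :
    IsTrajectory A B T 0 (fun t => NormedSpace.exp (t • A) x) := by
  refine ⟨fun t _ => (hasDerivAt_exp_smul_apply A x t).continuousAt.continuousWithinAt,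
    ∅, fun t _ _ => ?_⟩
  simpa using hasDerivAt_exp_smul_apply A x t

/-- By linearity a state `x₀` can be steered at time `1` to every state that differs from its free
evolution `exp A x₀` by a state reachable from `0`. -/
lemma exists_trajectory_of_mem_reachable {A : E →L[ℝ] E} {B : V →ₗ[ℝ] E} (x₀ : E) {y : E}
    (hy : y ∈ reachable A B) : ∃ u : ℝ → V, PiecewiseConstant 1 u ∧ ∃ X : ℝ → E,
      IsTrajectory A B 1 u X ∧ X 0 = x₀ ∧ X 1 = y + NormedSpace.exp A x₀ := by
  obtain ⟨u, hu, X, hX, h0, h1⟩ := hy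
  refine ⟨u, hu.piecewiseConstant one_pos, _,
    (add_zero u) ▸ hX.add (isTrajectory_exp A B 1 x₀), ?_, ?_⟩
  · simp [h0, NormedSpace.exp_zero]
  · simp [h1]

/-- Approximate controllability means that the Krylov space is dense. -/
theorem isApproxControllable_iff {A : E →L[ℝ] E} {B : V →ₗ[ℝ] E} :
    IsApproxControllable A B ↔ (krylov A B).topologicalClosure = ⊤ := by
  constructor
  · intro h
    refine eq_top_iff.2 fun x _ => ?_
    rw [← SetLike.mem_coe, Submodule.topologicalClosure_coe, ← closure_closure]
    refine Metric.mem_closure_iff.2 fun ε hε => ?_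
    obtain ⟨T, hT, u, -, X, hX, h0, h1⟩ := h ε hε 0 x
    exact ⟨X T, hX.mem_closure_krylov hT.le h0, by rwa [dist_eq_norm, norm_sub_rev]⟩
  · intro h ε hε x₀ x₁
    have hR : x₁ - NormedSpace.exp A x₀ ∈ (reachable A B).topologicalClosure := by
      have : (krylov A B).topologicalClosure ≤ (reachable A B).topologicalClosure :=
        Submodule.topologicalClosure_minimal _ (krylov_le_closure_reachable A B)
          (Submodule.isClosed_topologicalClosure _)
      exact this (h ▸ Submodule.mem_top)
    obtain ⟨y, hy, hd⟩ := Metric.mem_closure_iff.1 hR ε hε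
    obtain ⟨u, hu, X, hX, h0, h1⟩ := exists_trajectory_of_mem_reachable x₀ hy
    refine ⟨1, one_pos, u, hu, X, hX, h0, ?_⟩
    rw [h1, ← dist_eq_norm, dist_comm]
    convert hd using 1
    rw [dist_eq_norm, dist_eq_norm]
    congr 1
    abel

/-- Kalman's criterion: in finite dimension every subspace is closed, so that exact controllability
means that the Krylov space is everything. -/
theorem isControllable_iff [FiniteDimensional ℝ E] {A : E →L[ℝ] E} {B : V →ₗ[ℝ] E} :
    IsControllable A B ↔ krylov A B = ⊤ := by
  have hcl : ∀ N : Submodule ℝ E, N.topologicalClosure = N := fun N =>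
    N.closed_of_finiteDimensional.submodule_topologicalClosure_eq
  constructor
  · intro h
    refine eq_top_iff.2 fun x _ => ?_
    obtain ⟨T, hT, u, -, X, hX, h0, rfl⟩ := h 0 x
    rw [← hcl (krylov A B)]
    exact hX.mem_closure_krylov hT.le h0
  · intro h x₀ x₁
    have hR : x₁ - NormedSpace.exp A x₀ ∈ reachable A B := by
      have := krylov_le_closure_reachable A B
      rw [h, hcl] at this
      exact this Submodule.mem_top
    obtain ⟨u, hu, X, hX, h0, h1⟩ := exists_trajectory_of_mem_reachable x₀ hR
    exact ⟨1, one_pos, u, hu, X, hX, h0, by rw [h1, sub_add_cancel]⟩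

end Banach

/-! ### A Stone–Weierstrass theorem for submodules -/

/-- Let `M` be a subspace of `C(Y, ℝ)` stable under multiplication by the functions in `S`. If `M`
is dense on each of the sets on which all functions in `S` are constant, then `M` is dense.

The functions in `S` map `Y` onto a compact set `Z`; by the Stone–Weierstrass theorem the closure of
`M` is stable under multiplication by all continuous functions on `Z`, so that approximants near
the single fibres can be glued by a partition of unity on `Z`. -/
theorem topologicalClosure_eq_top_of_fiberwise {Y : Type*} [TopologicalSpace Y] [CompactSpace Y]
    (S : Set C(Y, ℝ)) (M : Submodule ℝ C(Y, ℝ)) (hM : ∀ a ∈ S, ∀ f ∈ M, a * f ∈ M)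
    (hfib : ∀ (y₀ : Y) (g : C(Y, ℝ)) (ε : ℝ), 0 < ε →
      ∃ h ∈ M, ∀ y, (∀ a ∈ S, a y = a y₀) → |h y - g y| < ε) :
    M.topologicalClosure = ⊤ := by
  classical
  let ν' : C(Y, S → ℝ) := ⟨fun y a => a.1 y, by fun_prop⟩
  let Z : Set (S → ℝ) := Set.range ν'
  have : CompactSpace Z := isCompact_iff_compactSpace.1 (isCompact_range ν'.continuous)
  let ν : C(Y, Z) := ⟨fun y => ⟨ν' y, y, rfl⟩, by fun_prop⟩
  have hMcl : IsClosed (M.topologicalClosure : Set C(Y, ℝ)) := M.isClosed_topologicalClosure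
  -- the algebra of functions on `Z` that multiply the closure of `M` into itself
  let Q : Subalgebra ℝ C(Z, ℝ) :=
    { carrier := {φ | ∀ f ∈ M.topologicalClosure, φ.comp ν * f ∈ M.topologicalClosure}
      mul_mem' := fun {φ ψ} hφ hψ f hf => by
        have := hφ _ (hψ f hf)
        rwa [← mul_assoc] at this
      add_mem' := fun {φ ψ} hφ hψ f hf => by
        have := add_mem (hφ f hf) (hψ f hf)
        rwa [← add_mul] at this
      algebraMap_mem' := fun c f hf => by
        have : (algebraMap ℝ C(Z, ℝ) c).comp ν * f = c • f := by ext y; simp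
        rw [this]
        exact Submodule.smul_mem _ c hf }
  have hQcl : IsClosed (Q : Set C(Z, ℝ)) := by
    have : (Q : Set C(Z, ℝ)) = ⋂ f ∈ M.topologicalClosure,
        (fun φ : C(Z, ℝ) => φ.comp ν * f) ⁻¹' (M.topologicalClosure : Set C(Y, ℝ)) := by
      ext φ
      simp only [Set.mem_iInter]
      rfl
    rw [this]
    exact isClosed_biInter fun f _ =>
      hMcl.preimage ((ContinuousMap.continuous_precomp ν).mul continuous_const)
  have hQsep : Q.SeparatesPoints := by
    intro z w hzw
    obtain ⟨a, ha⟩ : ∃ a, z.1 a ≠ w.1 a := by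
      by_contra! h
      exact hzw (Subtype.ext (funext h))
    refine ⟨fun z => z.1 a, ⟨⟨fun z => z.1 a, (continuous_apply a).comp continuous_subtype_val⟩,
      ?_, rfl⟩, ha⟩
    intro f hf
    have hmaps : Set.MapsTo (fun f => a.1 * f) (M : Set C(Y, ℝ)) M := fun f hf => hM _ a.2 f hf
    exact hmaps.closure (by fun_prop) hf
  have hQ : ∀ φ : C(Z, ℝ), φ ∈ Q := fun φ => by
    have h := ContinuousMap.continuousMap_mem_subalgebra_closure_of_separatesPoints Q hQsep φ
    rw [← SetLike.mem_coe, Subalgebra.topologicalClosure_coe, hQcl.closure_eq] at h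
    exact h
  refine eq_top_iff.2 fun g _ => ?_
  rw [← SetLike.mem_coe, ← hMcl.closure_eq]
  refine Metric.mem_closure_iff.2 fun ε hε => ?_
  have hloc : ∀ z : Z, ∃ h ∈ M, ∀ y, ν y = z → |h y - g y| < ε / 2 := by
    rintro ⟨_, y₀, rfl⟩
    obtain ⟨h, hh, H⟩ := hfib y₀ g (ε / 2) (half_pos hε)
    refine ⟨h, hh, fun y hy => H y fun a ha => ?_⟩
    exact congrFun (congrArg Subtype.val hy) ⟨a, ha⟩
  choose h hh H using hloc
  -- `U z` consists of the points over whose whole fibre `h z` is close to `g`; it is open since `ν`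
  -- is a closed map
  let U : Z → Set Z := fun z => (ν '' {y | ε / 2 ≤ |h z y - g y|})ᶜ
  have hUo : ∀ z, IsOpen (U z) := fun z => by
    have hc : IsClosed {y | ε / 2 ≤ |h z y - g y|} := isClosed_le (by fun_prop) (by fun_prop)
    exact (hc.isCompact.image ν.continuous).isClosed.isOpen_compl
  have hUz : ∀ z, z ∈ U z := by
    rintro z ⟨y, hy, hyz⟩
    exact absurd (H z y hyz) (not_lt.2 hy)
  obtain ⟨t, ht⟩ := isCompact_univ.elim_finite_subcover U hUo
    (fun z _ => Set.mem_iUnion.2 ⟨z, hUz z⟩)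
  obtain ⟨ρ, hρ⟩ := PartitionOfUnity.exists_isSubordinate (s := (Set.univ : Set Z)) isClosed_univ
    (fun z : t => U z) (fun z => hUo z) (fun z hz => by
      obtain ⟨w, hw, hzw⟩ := Set.mem_iUnion₂.1 (ht hz)
      exact Set.mem_iUnion.2 ⟨⟨w, hw⟩, hzw⟩)
  refine ⟨∑ i : t, (ρ i).comp ν * h i, Submodule.sum_mem _ fun i _ =>
    hQ (ρ i) _ (M.le_topologicalClosure (hh i)), ?_⟩
  rw [dist_comm, ContinuousMap.dist_lt_iff hε]
  intro y
  have hsum : ∑ i : t, ρ i (ν y) = 1 := by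
    have := ρ.sum_eq_one (Set.mem_univ (ν y))
    rwa [finsum_eq_sum_of_fintype] at this
  have heq : (∑ i : t, (ρ i).comp ν * h i) y - g y = ∑ i : t, ρ i (ν y) * (h i y - g y) := by
    simp only [mul_sub, Finset.sum_sub_distrib, ← Finset.sum_mul, hsum, one_mul]
    simp
  rw [Real.dist_eq, heq]
  calc |∑ i : t, ρ i (ν y) * (h i y - g y)|
      ≤ ∑ i : t, ρ i (ν y) * (ε / 2) := by
        refine (Finset.abs_sum_le_sum_abs _ _).trans (Finset.sum_le_sum fun i _ => ?_)
        rw [abs_mul, abs_of_nonneg (ρ.nonneg i _)]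
        by_cases h0 : ρ i (ν y) = 0
        · simp [h0]
        · refine mul_le_mul_of_nonneg_left ?_ (ρ.nonneg i _)
          have hy : ν y ∈ U i := hρ i (subset_tsupport _ h0)
          by_contra! hlt
          exact hy ⟨y, hlt.le, rfl⟩
    _ = ε / 2 := by rw [← Finset.sum_mul, hsum, one_mul]
    _ < ε := half_lt_self hε

/-- The version of `topologicalClosure_eq_top_of_fiberwise` for vector-valued functions, regarded
as real functions on `K × ι`. -/
theorem topologicalClosure_eq_top_of_fiberwise_pi {K ι : Type*} [TopologicalSpace K]
    [CompactSpace K] [Fintype ι] (S : Set C(K, ι → ℝ)) (L : Submodule ℝ C(K, ι → ℝ))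
    (hL : ∀ a ∈ S, ∀ f ∈ L, a * f ∈ L)
    (hfib : ∀ (β₀ : K) (i₀ : ι) (g : C(K, ι → ℝ)), ∃ h ∈ L, ∀ β i,
      (∀ a ∈ S, a β i = a β₀ i₀) → h β i = g β i) :
    L.topologicalClosure = ⊤ := by
  let _ : TopologicalSpace ι := ⊥
  have : DiscreteTopology ι := ⟨rfl⟩
  let c : C(K × ι, ℝ) →ₗ[ℝ] C(K, ι → ℝ) :=
    { toFun := fun f => ⟨fun β i => f (β, i), by fun_prop⟩
      map_add' := fun _ _ => rfl
      map_smul' := fun _ _ => rfl }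
  let d : C(K, ι → ℝ) → C(K × ι, ℝ) := fun g => ⟨fun p => g p.1 p.2, by
    refine continuous_prod_of_discrete_right.2 fun i => ?_
    exact (continuous_apply i).comp g.continuous⟩
  have hcd : ∀ g, c (d g) = g := fun g => rfl
  have hdc : ∀ g, d (c g) = g := fun g => rfl
  have htop : (L.comap c).topologicalClosure = ⊤ := by
    refine topologicalClosure_eq_top_of_fiberwise (d '' S) _ ?_ ?_
    · rintro _ ⟨a, ha, rfl⟩ f hf
      exact hL a ha _ hf
    · rintro ⟨β₀, i₀⟩ g ε hε
      obtain ⟨h, hh, H⟩ := hfib β₀ i₀ (c g)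
      refine ⟨d h, hh, fun y hy => ?_⟩
      have : h y.1 y.2 = g y := H y.1 y.2 fun a ha => hy _ ⟨a, ha, rfl⟩
      change |h y.1 y.2 - g y| < ε
      simpa [this] using hε
  refine eq_top_iff.2 fun g _ => Metric.mem_closure_iff.2 fun ε hε => ?_
  have hg : d g ∈ (L.comap c).topologicalClosure := htop ▸ Submodule.mem_top
  obtain ⟨f, hf, hd⟩ := Metric.mem_closure_iff.1 hg ε hε
  refine ⟨c f, hf, (ContinuousMap.dist_lt_iff hε).2 fun β => (dist_pi_lt_iff hε).2 fun i => ?_⟩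
  exact (ContinuousMap.dist_lt_iff hε).1 hd (β, i)

/-! ### Ensembles and their finite subsystems -/

/-- When the control values form `ℝᵐ`, the unit vectors suffice as inputs. -/
lemma krylov_pi {E κ : Type*} [NormedAddCommGroup E] [NormedSpace ℝ E] [Fintype κ] [DecidableEq κ]
    (A : E →L[ℝ] E) (B : (κ → ℝ) →ₗ[ℝ] E) :
    krylov A B =
      Submodule.span ℝ {x | ∃ (j : κ) (k : ℕ), x = (A ^ k) (B (Pi.single j 1))} := by
  refine le_antisymm (Submodule.span_le.2 ?_) (Submodule.span_mono ?_)
  · rintro _ ⟨k, v, rfl⟩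
    rw [pi_eq_sum_univ' v, map_sum, map_sum]
    refine Submodule.sum_mem _ fun j _ => ?_
    rw [map_smul, map_smul]
    refine Submodule.smul_mem _ _ (Submodule.subset_span ⟨j, k, ?_⟩)
    congr 2
  · rintro _ ⟨j, k, rfl⟩
    exact ⟨k, _, rfl⟩

/-- By the Cayley–Hamilton theorem the powers of `T` below the dimension span the orbit of `b`. -/
lemma pow_apply_mem_span_lt_finrank {E : Type*} [AddCommGroup E] [Module ℝ E]
    [FiniteDimensional ℝ E] (T : E →ₗ[ℝ] E) (b : E) (k : ℕ) :
    (T ^ k) b ∈ Submodule.span ℝ {x | ∃ i < Module.finrank ℝ E, x = (T ^ i) b} := by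
  rw [LinearMap.pow_eq_aeval_mod_charpoly]
  rcases Nat.eq_zero_or_pos (Module.finrank ℝ E) with h0 | hpos
  · have := Module.finrank_zero_iff.1 h0
    rw [Subsingleton.elim ((Polynomial.aeval T _) b) 0]
    exact Submodule.zero_mem _
  have hdeg : (Polynomial.X ^ k %ₘ T.charpoly).natDegree < Module.finrank ℝ E := by
    rw [← T.charpoly_natDegree]
    refine Polynomial.natDegree_modByMonic_lt _ T.charpoly_monic fun h => ?_
    have := T.charpoly_natDegree
    rw [h, Polynomial.natDegree_one] at this
    omega
  rw [Polynomial.aeval_eq_sum_range, LinearMap.sum_apply]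
  refine Submodule.sum_mem _ fun i hi => ?_
  rw [LinearMap.smul_apply]
  refine Submodule.smul_mem _ _ (Submodule.subset_span ⟨i, ?_, rfl⟩)
  exact (Nat.lt_succ_iff.1 (Finset.mem_range.1 hi)).trans_lt hdeg

section Subsystem

variable {K ι κ : Type*} [Fintype ι] [Fintype κ]

/-- `stackDiag M S` as a continuous linear operator. -/
def stackDiagL (M : K → Matrix ι ι ℝ) (S : Set K) : (S → ι → ℝ) →L[ℝ] (S → ι → ℝ) where
  toFun := stackDiag M S
  map_add' _ _ := funext fun _ => Matrix.mulVec_add _ _ _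
  map_smul' c _ := funext fun β => Matrix.mulVec_smul (M β) c _
  cont := continuous_pi fun β => Continuous.matrix_mulVec continuous_const (continuous_apply β)

/-- `stackCol M S` as a linear map. -/
def stackColL (M : K → Matrix ι κ ℝ) (S : Set K) : (κ → ℝ) →ₗ[ℝ] (S → ι → ℝ) where
  toFun := stackCol M S
  map_add' _ _ := funext fun _ => Matrix.mulVec_add _ _ _
  map_smul' c _ := funext fun β => Matrix.mulVec_smul (M β) c _

lemma SubsystemControllable.mono {A : K → Matrix ι ι ℝ} {B : K → Matrix ι κ ℝ} {S S' : Set K}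
    (h : SubsystemControllable A B S) (hS : S' ⊆ S) : SubsystemControllable A B S' := by
  classical
  let p : (S → ι → ℝ) →L[ℝ] (S' → ι → ℝ) :=
    { toFun := fun y β => y ⟨β, hS β.2⟩
      map_add' := fun _ _ => rfl
      map_smul' := fun _ _ => rfl
      cont := continuous_pi fun β => continuous_apply _ }
  refine IsControllable.map p (fun y => ?_) (fun _ => rfl) (fun _ => rfl) h
  exact ⟨fun β => if hβ : (β : K) ∈ S' then y ⟨β, hβ⟩ else 0, funext fun β => by simp [p]⟩

variable [DecidableEq ι]

/-- The span of the columns of all the matrices `𝒟_A(S)ᵏ 𝒱_B(S)`. -/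
def subsystemKrylov (A : K → Matrix ι ι ℝ) (B : K → Matrix ι κ ℝ) (S : Set K) :
    Submodule ℝ (S → ι → ℝ) :=
  Submodule.span ℝ {y | ∃ (j : κ) (k : ℕ), y = fun (β : S) i => (A β ^ k * B β) i j}

lemma stackDiagL_pow (A : K → Matrix ι ι ℝ) (S : Set K) (k : ℕ) (y : S → ι → ℝ) :
    (stackDiagL A S ^ k) y = fun (β : S) => A β ^ k *ᵥ y β := by
  induction k generalizing y with
  | zero => simp
  | succ k ih =>
    rw [pow_succ, mul_apply_eq_comp, ih]
    funext β
    simp [stackDiagL, stackDiag, pow_succ]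

lemma stackDiagL_pow_col [DecidableEq κ] (A : K → Matrix ι ι ℝ) (B : K → Matrix ι κ ℝ) (S : Set K)
    (k : ℕ) (j : κ) :
    (stackDiagL A S ^ k) (stackColL B S (Pi.single j 1)) = fun (β : S) i => (A β ^ k * B β) i j := by
  rw [stackDiagL_pow]
  funext β i
  simp [stackColL, stackCol, Matrix.mul_apply, Matrix.mulVec, dotProduct, Pi.single_apply]

/-- Kalman's criterion for the subsystem indexed by a finite set of parameters. -/
lemma subsystemControllable_iff {A : K → Matrix ι ι ℝ} {B : K → Matrix ι κ ℝ} {S : Set K}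
    (hS : S.Finite) : SubsystemControllable A B S ↔ subsystemKrylov A B S = ⊤ := by
  classical
  have := hS.fintype
  have h := isControllable_iff (A := stackDiagL A S) (B := stackColL B S)
  have hk : krylov (stackDiagL A S) (stackColL B S) = subsystemKrylov A B S := by
    rw [krylov_pi]
    simp only [stackDiagL_pow_col]
    rfl
  rw [hk] at h
  exact h

/-- The controllability matrix contains only the powers of `A` below the dimension `n |S|` of
`(ℝⁿ)^S`, but these suffice to span the Krylov space. -/
lemma rank_ensembleControllabilityMatrix_iff {A : K → Matrix ι ι ℝ} {B : K → Matrix ι κ ℝ}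
    {S : Set K} (hS : S.Finite) :
    (ensembleControllabilityMatrix A B S).rank = Fintype.card ι * S.ncard ↔
      subsystemKrylov A B S = ⊤ := by
  classical
  have := hS.fintype
  set N := Fintype.card ι * S.ncard with hN
  have hcard : S.ncard = Fintype.card S := by
    rw [← Nat.card_coe_set_eq, Nat.card_eq_fintype_card]
  have hfin : Module.finrank ℝ (S → ι → ℝ) = N := by
    rw [(LinearEquiv.curry ℝ ℝ S ι).symm.finrank_eq, Module.finrank_fintype_fun_eq_card,
      Fintype.card_prod, hN, hcard, mul_comm]
  set e := LinearEquiv.curry ℝ ℝ S ι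
  have hfin' : Module.finrank ℝ (S × ι → ℝ) = N := by rw [← hfin]; exact e.finrank_eq
  have hmap : Submodule.map (e : (S × ι → ℝ) →ₗ[ℝ] (S → ι → ℝ))
      (LinearMap.range (ensembleControllabilityMatrix A B S).mulVecLin) =
      subsystemKrylov A B S := by
    rw [Matrix.range_mulVecLin, Submodule.map_span, subsystemKrylov]
    refine le_antisymm (Submodule.span_mono ?_) (Submodule.span_le.2 ?_)
    · rintro _ ⟨_, ⟨⟨k, j⟩, rfl⟩, rfl⟩
      exact ⟨j, k, rfl⟩
    · rintro _ ⟨j, k, rfl⟩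
      have h := pow_apply_mem_span_lt_finrank
        (stackDiagL A S : (S → ι → ℝ) →ₗ[ℝ] (S → ι → ℝ)) (stackColL B S (Pi.single j 1)) k
      simp only [← ContinuousLinearMap.toLinearMap_pow, ContinuousLinearMap.coe_coe,
        stackDiagL_pow_col, hfin] at h
      refine Submodule.span_mono ?_ h
      rintro _ ⟨i, hi, rfl⟩
      exact ⟨_, ⟨(⟨i, hi⟩, j), rfl⟩, rfl⟩
  rw [← hmap, Matrix.rank]
  constructor
  · intro h
    rw [Submodule.eq_top_of_finrank_eq (h.trans hfin'.symm), Submodule.map_top, LinearEquiv.range]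
  · intro h
    rw [← LinearEquiv.finrank_map_eq e, h, finrank_top, hfin]

/-- If the `i`-th row of `A(β)ᵏ` does not depend on `β ∈ S`, then the `i`-th components of the
functions `Aᵏ b_j` on `S` lie in the span of the entries of `B`, which bounds the size of `S`. -/
lemma ncard_le_of_row_const {A : K → Matrix ι ι ℝ} {B : K → Matrix ι κ ℝ} {S : Set K}
    (hS : S.Finite) (i : ι)
    (hrow : ∀ k : ℕ, ∀ β ∈ S, ∀ β' ∈ S, (A β ^ k) i = (A β' ^ k) i)
    (htop : subsystemKrylov A B S = ⊤) : S.ncard ≤ Fintype.card (ι × κ) := by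
  classical
  have := hS.fintype
  rcases S.eq_empty_or_nonempty with rfl | ⟨β₀, hβ₀⟩
  · simp
  let ev : (S → ι → ℝ) →ₗ[ℝ] (S → ℝ) :=
    { toFun := fun y β => y β i
      map_add' := fun _ _ => rfl
      map_smul' := fun _ _ => rfl }
  have hev : Function.Surjective ev := fun z => ⟨fun β _ => z β, rfl⟩
  let b : ι × κ → S → ℝ := fun p β => B β p.1 p.2
  have hle : Submodule.map ev (subsystemKrylov A B S) ≤ Submodule.span ℝ (Set.range b) := by
    rw [subsystemKrylov, Submodule.map_span, Submodule.span_le]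
    rintro _ ⟨_, ⟨j, k, rfl⟩, rfl⟩
    have : ev (fun (β : S) i => (A β ^ k * B β) i j) = ∑ i', (A β₀ ^ k) i i' • b (i', j) := by
      funext β
      change (A β ^ k * B β) i j = _
      rw [Matrix.mul_apply, hrow k β β.2 β₀ hβ₀]
      simp [b]
    rw [this]
    exact Submodule.sum_mem _ fun i' _ => Submodule.smul_mem _ _ (Submodule.subset_span ⟨_, rfl⟩)
  rw [htop, Submodule.map_top, LinearMap.range_eq_top.2 hev, top_le_iff] at hle
  have h := finrank_range_le_card (R := ℝ) b
  rw [Set.finrank, hle, finrank_top, Module.finrank_fintype_fun_eq_card] at h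
  rwa [← Nat.card_coe_set_eq, Nat.card_eq_fintype_card]

lemma finite_of_row_const {A : K → Matrix ι ι ℝ} {B : K → Matrix ι κ ℝ} {S : Set K} (i : ι)
    (hrow : ∀ k : ℕ, ∀ β ∈ S, ∀ β' ∈ S, (A β ^ k) i = (A β' ^ k) i)
    (htop : ∀ S' ⊆ S, S'.Finite → subsystemKrylov A B S' = ⊤) : S.Finite := by
  by_contra hS
  obtain ⟨S', hS', hfin, hcard⟩ := Set.Infinite.exists_subset_ncard_eq hS
    (Fintype.card (ι × κ) + 1)
  have := ncard_le_of_row_const hfin i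
    (fun k β hβ β' hβ' => hrow k β (hS' hβ) β' (hS' hβ')) (htop S' hS' hfin)
  omega

end Subsystem

section Ensemble

variable {K ι κ : Type*} [TopologicalSpace K] [Fintype ι]

/-- `mulVecC M` as a continuous linear operator. -/
def mulVecL [CompactSpace K] (M : C(K, Matrix ι ι ℝ)) : C(K, ι → ℝ) →L[ℝ] C(K, ι → ℝ) where
  toFun := mulVecC M
  map_add' f g := by ext β : 1; exact Matrix.mulVec_add _ _ _
  map_smul' c f := by ext β : 1; exact Matrix.mulVec_smul (M β) c _
  cont := by
    refine ContinuousMap.continuous_of_continuous_uncurry _ ?_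
    exact (M.continuous.comp continuous_snd).matrix_mulVec
      (continuous_eval.comp (by fun_prop : Continuous fun p : C(K, ι → ℝ) × K => (p.1, p.2)))

/-- Restriction of functions on `K` to `S`. -/
def restrictL (ι : Type*) (S : Set K) : C(K, ι → ℝ) →L[ℝ] (S → ι → ℝ) where
  toFun f β := f β
  map_add' _ _ := rfl
  map_smul' _ _ := rfl
  cont := by fun_prop

variable [DecidableEq ι]

lemma mulVecL_pow [CompactSpace K] (A : C(K, Matrix ι ι ℝ)) (k : ℕ) (f : C(K, ι → ℝ)) :
    (mulVecL A ^ k) f = mulVecC (A ^ k) f := by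
  induction k generalizing f with
  | zero => ext β : 1; simp [mulVecC]
  | succ k ih =>
    rw [pow_succ, mul_apply_eq_comp, ih, pow_succ]
    ext β : 1
    simp [mulVecC, mulVecL]

lemma mulVecC_mem_reachableSpan {A : C(K, Matrix ι ι ℝ)} {B : C(K, Matrix ι κ ℝ)}
    {f : C(K, ι → ℝ)} (hf : f ∈ reachableSpan A B) : mulVecC A f ∈ reachableSpan A B := by
  induction hf using Submodule.span_induction with
  | mem f hf =>
    obtain ⟨j, k, rfl⟩ := hf
    refine Submodule.subset_span ⟨j, k + 1, ?_⟩
    ext β : 1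
    simp [mulVecC, pow_succ']
  | zero =>
    convert (reachableSpan A B).zero_mem
    ext β : 1
    exact Matrix.mulVec_zero _
  | add f g _ _ hf hg =>
    convert add_mem hf hg
    ext β : 1
    exact Matrix.mulVec_add _ _ _
  | smul c f _ hf =>
    convert Submodule.smul_mem _ c hf
    ext β : 1
    exact Matrix.mulVec_smul (A β) c _

lemma map_restrictL_reachableSpan (A : C(K, Matrix ι ι ℝ)) (B : C(K, Matrix ι κ ℝ)) (S : Set K) :
    (reachableSpan A B).map (restrictL ι S : C(K, ι → ℝ) →ₗ[ℝ] (S → ι → ℝ)) =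
      subsystemKrylov A B S := by
  have hval : ∀ j k, restrictL ι S (mulVecC (A ^ k) (columnC B j)) =
      fun (β : S) i => ((A β) ^ k * B β) i j := by
    intro j k
    funext β i
    simp [restrictL, mulVecC, columnC, Matrix.mul_apply, Matrix.mulVec, dotProduct]
  rw [reachableSpan, Submodule.map_span, subsystemKrylov]
  congr 1
  ext y
  constructor
  · rintro ⟨_, ⟨j, k, rfl⟩, rfl⟩
    exact ⟨j, k, hval j k⟩
  · rintro ⟨j, k, rfl⟩
    exact ⟨_, ⟨j, k, rfl⟩, hval j k⟩

/-- Restricting to a finite set of parameters sends a dense subspace onto everything. -/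
lemma subsystemKrylov_eq_top_of_dense [T4Space K] {A : C(K, Matrix ι ι ℝ)}
    {B : C(K, Matrix ι κ ℝ)} (h : (reachableSpan A B).topologicalClosure = ⊤) {S : Set K}
    (hS : S.Finite) : subsystemKrylov A B S = ⊤ := by
  have := hS.fintype
  have hsurj : Function.Surjective (restrictL ι S : C(K, ι → ℝ) →L[ℝ] (S → ι → ℝ)) := by
    intro y
    obtain ⟨g, hg⟩ := ContinuousMap.exists_restrict_eq hS.isClosed
      (⟨y, continuous_of_discreteTopology⟩ : C(S, ι → ℝ))
    exact ⟨g, funext fun β => congrArg (fun f : C(S, ι → ℝ) => f β) hg⟩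
  have hd : Dense ((reachableSpan A B : Submodule ℝ _) : Set C(K, ι → ℝ)) :=
    Submodule.dense_iff_topologicalClosure_eq_top.2 h
  have hd' := hsurj.denseRange.dense_image (restrictL ι S).continuous hd
  have hcl : IsClosed ((subsystemKrylov A B S : Submodule ℝ _) : Set (S → ι → ℝ)) :=
    Submodule.closed_of_finiteDimensional _
  refine SetLike.coe_injective ?_
  rw [← hcl.closure_eq, ← map_restrictL_reachableSpan]
  exact hd'.closure_eq

variable [Fintype κ]

/-- The operator `u ↦ B u` from the space of control values to `C(K, ℝⁿ)`. -/
def inputL (B : C(K, Matrix ι κ ℝ)) : (κ → ℝ) →ₗ[ℝ] C(K, ι → ℝ) where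
  toFun u := mulVecC B (ContinuousMap.const K u)
  map_add' f g := by ext β : 1; exact Matrix.mulVec_add _ _ _
  map_smul' c f := by ext β : 1; exact Matrix.mulVec_smul (B β) c _

lemma uniformlyEnsembleControllable_iff [CompactSpace K] {A : C(K, Matrix ι ι ℝ)}
    {B : C(K, Matrix ι κ ℝ)} :
    UniformlyEnsembleControllable A B ↔ (reachableSpan A B).topologicalClosure = ⊤ := by
  classical
  have h := isApproxControllable_iff (A := mulVecL A) (B := inputL B)
  have hk : krylov (mulVecL A) (inputL B) = reachableSpan A B := by
    rw [krylov_pi]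
    have hcol : ∀ j, inputL B (Pi.single j 1) = columnC B j := fun j => by
      ext β i
      simp [inputL, mulVecC, columnC]
    simp only [mulVecL_pow, hcol]
    rfl
  rw [hk] at h
  exact h

end Ensemble

/-! ### Drift in real Jordan form -/

lemma FiniteToOne.finite_preimage {K : Type*} {f : K → ℂ} (hf : FiniteToOne f) (η : ℂ) :
    (f ⁻¹' {η}).Finite := by
  by_cases h : η ∈ Set.range f
  · exact hf η h
  · rw [Set.preimage_singleton_eq_empty.2 h]
    exact Set.finite_empty

section Jordan

variable {K : Type*} [TopologicalSpace K] {r l : ℕ}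

lemma jordanDrift_mulVec (lam : Fin r → C(K, ℝ)) (α ω : Fin l → C(K, ℝ)) (β : K)
    (x : Coord r l → ℝ) :
    (∀ j, (jordanDrift lam α ω β *ᵥ x) (Sum.inl j) = lam j β * x (Sum.inl j)) ∧
    (∀ j, (jordanDrift lam α ω β *ᵥ x) (Sum.inr (0, j)) =
      α j β * x (Sum.inr (0, j)) - ω j β * x (Sum.inr (1, j))) ∧
    ∀ j, (jordanDrift lam α ω β *ᵥ x) (Sum.inr (1, j)) =
      ω j β * x (Sum.inr (0, j)) + α j β * x (Sum.inr (1, j)) := by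
  refine ⟨fun j => ?_, fun j => ?_, fun j => ?_⟩ <;>
  simp [jordanDrift, Matrix.mulVec, dotProduct, Matrix.diagonal_apply, Fintype.sum_prod_type,
    Matrix.blockDiagonal_apply, sub_eq_add_neg]

lemma jordanDriftStar_mulVec (lam : Fin r → C(K, ℝ)) (α ω : Fin l → C(K, ℝ)) (β : K)
    (x : Coord r l → ℝ) :
    (∀ j, (jordanDriftStar lam α ω β *ᵥ x) (Sum.inl j) = lam j β * x (Sum.inl j)) ∧
    (∀ j, (jordanDriftStar lam α ω β *ᵥ x) (Sum.inr (0, j)) =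
      α j β * x (Sum.inr (0, j)) + ω j β * x (Sum.inr (1, j))) ∧
    ∀ j, (jordanDriftStar lam α ω β *ᵥ x) (Sum.inr (1, j)) =
      -ω j β * x (Sum.inr (0, j)) + α j β * x (Sum.inr (1, j)) := by
  refine ⟨fun j => ?_, fun j => ?_, fun j => ?_⟩ <;>
  simp [jordanDriftStar, Matrix.mulVec, dotProduct, Matrix.diagonal_apply, Fintype.sum_prod_type,
    Matrix.blockDiagonal_apply]

/-- The diagonal of `A + A*`: twice the real parts of the eigenvalues. -/
def twiceReEig (lam : Fin r → C(K, ℝ)) (α : Fin l → C(K, ℝ)) : C(K, Coord r l → ℝ) :=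
  ⟨fun β => Sum.elim (fun j => 2 * lam j β) (fun p => 2 * α p.2 β), by
    refine continuous_pi fun i => ?_
    rcases i with j | p <;> simp only [Sum.elim_inl, Sum.elim_inr] <;> fun_prop⟩

/-- The diagonal of `A A*`: the squared absolute values of the eigenvalues. -/
def normSqEig (lam : Fin r → C(K, ℝ)) (α ω : Fin l → C(K, ℝ)) : C(K, Coord r l → ℝ) :=
  ⟨fun β => Sum.elim (fun j => lam j β ^ 2) (fun p => α p.2 β ^ 2 + ω p.2 β ^ 2), by
    refine continuous_pi fun i => ?_
    rcases i with j | p <;> simp only [Sum.elim_inl, Sum.elim_inr] <;> fun_prop⟩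

lemma twiceReEig_mul (lam : Fin r → C(K, ℝ)) (α ω : Fin l → C(K, ℝ)) (f : C(K, Coord r l → ℝ)) :
    twiceReEig lam α * f =
      mulVecC (jordanDrift lam α ω) f + mulVecC (jordanDriftStar lam α ω) f := by
  ext β i
  obtain ⟨h1, h2, h3⟩ := jordanDrift_mulVec lam α ω β (f β)
  obtain ⟨h1', h2', h3'⟩ := jordanDriftStar_mulVec lam α ω β (f β)
  rcases i with j | ⟨i, j⟩
  · simp [twiceReEig, mulVecC, h1, h1']
    ring
  · fin_cases i
    · simp [twiceReEig, mulVecC, h2, h2']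
      ring
    · simp [twiceReEig, mulVecC, h3, h3']
      ring

lemma normSqEig_mul (lam : Fin r → C(K, ℝ)) (α ω : Fin l → C(K, ℝ)) (f : C(K, Coord r l → ℝ)) :
    normSqEig lam α ω * f =
      mulVecC (jordanDrift lam α ω) (mulVecC (jordanDriftStar lam α ω) f) := by
  ext β i
  obtain ⟨h1, h2, h3⟩ := jordanDrift_mulVec lam α ω β (jordanDriftStar lam α ω β *ᵥ f β)
  obtain ⟨h1', h2', h3'⟩ := jordanDriftStar_mulVec lam α ω β (f β)
  rcases i with j | ⟨i, j⟩
  · simp [normSqEig, mulVecC, -Matrix.mulVec_mulVec, h1, h1']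
    ring
  · fin_cases i
    · simp [normSqEig, mulVecC, -Matrix.mulVec_mulVec, h2, h2', h3']
      ring
    · simp [normSqEig, mulVecC, -Matrix.mulVec_mulVec, h3, h2', h3']
      ring

/-- An eigenvalue of `A(β)` belonging to the given coordinate; of a conjugate pair it is
`α_j + i ω_j`, for both coordinates of the pair. -/
def coordEig (lam : Fin r → C(K, ℝ)) (α ω : Fin l → C(K, ℝ)) (β : K) : Coord r l → ℂ :=
  Sum.elim (fun j => realEig (lam j) β) (fun p => eigPlus (α p.2) (ω p.2) β)

lemma coordEig_mem_eigenvalueSet (lam : Fin r → C(K, ℝ)) (α ω : Fin l → C(K, ℝ)) (β : K)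
    (i : Coord r l) : coordEig lam α ω β i ∈ eigenvalueSet lam α ω := by
  rcases i with j | ⟨i, j⟩
  · exact Or.inl (Or.inl (Set.mem_iUnion.2 ⟨j, β, rfl⟩))
  · exact Or.inl (Or.inr (Set.mem_iUnion.2 ⟨j, β, rfl⟩))

lemma twiceReEig_apply (lam : Fin r → C(K, ℝ)) (α ω : Fin l → C(K, ℝ)) (β : K) (i : Coord r l) :
    twiceReEig lam α β i = 2 * (coordEig lam α ω β i).re := by
  rcases i with j | ⟨i, j⟩ <;> simp [twiceReEig, coordEig, realEig, eigPlus]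

lemma normSqEig_apply (lam : Fin r → C(K, ℝ)) (α ω : Fin l → C(K, ℝ)) (β : K) (i : Coord r l) :
    normSqEig lam α ω β i = (coordEig lam α ω β i).re ^ 2 + (coordEig lam α ω β i).im ^ 2 := by
  rcases i with j | ⟨i, j⟩ <;> simp [normSqEig, coordEig, realEig, eigPlus]

/-- The fibre of `η` contains every parameter at which `η` or its conjugate is an eigenvalue. -/
lemma mem_eigenvalueFiber_of_coordEig {lam : Fin r → C(K, ℝ)} {α ω : Fin l → C(K, ℝ)} {β : K}
    {i : Coord r l} {η : ℂ} (hre : (coordEig lam α ω β i).re = η.re)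
    (him : (coordEig lam α ω β i).im ^ 2 = η.im ^ 2) : β ∈ eigenvalueFiber lam α ω η := by
  rcases i with j | ⟨i, j⟩
  · refine Or.inl (Or.inl (Set.mem_iUnion.2 ⟨j, ?_⟩))
    simp only [coordEig, Sum.elim_inl, realEig, Complex.ofReal_re, Complex.ofReal_im] at hre him
    have : η.im = 0 := by simpa using him.symm
    exact Complex.ext (by simpa [realEig] using hre) (by simp [realEig, this])
  · simp only [coordEig, Sum.elim_inr] at hre him
    rcases sq_eq_sq_iff_eq_or_eq_neg.1 him with h | h
    · exact Or.inl (Or.inr (Set.mem_iUnion.2 ⟨j, Complex.ext hre h⟩))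
    · refine Or.inr (Set.mem_iUnion.2 ⟨j, Complex.ext ?_ ?_⟩)
      · rw [← hre]
        simp [eigMinus, eigPlus]
      · rw [← neg_eq_iff_eq_neg.2 h]
        simp [eigMinus, eigPlus]

/-- If every finite fibre of the eigenvalues can be interpolated by `𝓛`, then `𝓛` is dense: it is
stable under multiplication by the diagonals of `A + A*` and `A A*`, which together determine an
eigenvalue up to conjugation. -/
lemma dense_of_subsystemKrylov_eq_top [CompactSpace K] {m : ℕ} {lam : Fin r → C(K, ℝ)}
    {α ω : Fin l → C(K, ℝ)} {B : C(K, Matrix (Coord r l) (Fin m) ℝ)}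
    (hclosed : ∀ f ∈ reachableSpan (jordanDrift lam α ω) B,
      mulVecC (jordanDriftStar lam α ω) f ∈ reachableSpan (jordanDrift lam α ω) B)
    (h : ∀ η ∈ eigenvalueSet lam α ω,
      subsystemKrylov (jordanDrift lam α ω) B (eigenvalueFiber lam α ω η) = ⊤) :
    (reachableSpan (jordanDrift lam α ω) B).topologicalClosure = ⊤ := by
  refine topologicalClosure_eq_top_of_fiberwise_pi {twiceReEig lam α, normSqEig lam α ω} _ ?_ ?_
  · rintro a (rfl | rfl) f hf
    · rw [twiceReEig_mul lam α ω]
      exact add_mem (mulVecC_mem_reachableSpan hf) (hclosed f hf)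
    · rw [normSqEig_mul]
      exact mulVecC_mem_reachableSpan (hclosed f hf)
  · intro β₀ i₀ g
    set η := coordEig lam α ω β₀ i₀ with hη
    have htop := h η (coordEig_mem_eigenvalueSet lam α ω β₀ i₀)
    rw [← map_restrictL_reachableSpan] at htop
    obtain ⟨f, hf, hfg⟩ : restrictL _ (eigenvalueFiber lam α ω η) g ∈ Submodule.map _ _ :=
      htop.symm ▸ Submodule.mem_top
    refine ⟨f, hf, fun β i hβ => ?_⟩
    have h1 := hβ _ (Or.inl rfl)
    have h2 := hβ _ (Or.inr rfl)
    rw [twiceReEig_apply lam α ω, twiceReEig_apply lam α ω, ← hη] at h1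
    rw [normSqEig_apply, normSqEig_apply, ← hη] at h2
    have hre : (coordEig lam α ω β i).re = η.re := by linarith
    have hmem : β ∈ eigenvalueFiber lam α ω η :=
      mem_eigenvalueFiber_of_coordEig hre (by rw [hre] at h2; linarith)
    exact congrFun (congrFun hfg ⟨β, hmem⟩) i

lemma jordanDrift_pow (lam : Fin r → C(K, ℝ)) (α ω : Fin l → C(K, ℝ)) (β : K) (k : ℕ) :
    jordanDrift lam α ω β ^ k =
      Matrix.fromBlocks (Matrix.diagonal fun j => lam j β ^ k) 0 0
        (Matrix.blockDiagonal fun j => !![α j β, -ω j β; ω j β, α j β] ^ k) := by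
  change (Matrix.fromBlocks _ 0 0 _) ^ k = _
  rw [Matrix.fromBlocks_diagonal_pow, Matrix.diagonal_pow, ← Matrix.blockDiagonal_pow]
  rfl

/-- The eigenvalue fibres are finite as soon as all their finite subsystems are controllable. -/
lemma finite_eigenvalueFiber {m : ℕ} {lam : Fin r → C(K, ℝ)} {α ω : Fin l → C(K, ℝ)}
    {B : C(K, Matrix (Coord r l) (Fin m) ℝ)} {η : ℂ}
    (htop : ∀ S ⊆ eigenvalueFiber lam α ω η, S.Finite →
      subsystemKrylov (jordanDrift lam α ω) B S = ⊤) : (eigenvalueFiber lam α ω η).Finite := by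
  -- on a set where `α j` and `ω j` are constant, so are the rows of `Aᵏ` in the `j`-th block
  have hpair : ∀ (j : Fin l) (S : Set K), (∀ β ∈ S, α j β = η.re) →
      (∀ β ∈ S, ∀ β' ∈ S, ω j β = ω j β') → S ⊆ eigenvalueFiber lam α ω η → S.Finite := by
    intro j S hα hω hS
    refine finite_of_row_const (Sum.inr (0, j)) (fun k β hβ β' hβ' => ?_)
      fun S' hS' => htop S' (hS'.trans hS)
    have h1 : α j β = α j β' := (hα β hβ).trans (hα β' hβ').symm
    have h2 := hω β hβ β' hβ'
    rw [jordanDrift_pow, jordanDrift_pow]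
    funext i
    rcases i with i | ⟨i, j'⟩
    · rfl
    · simp only [Matrix.fromBlocks_apply₂₂, Matrix.blockDiagonal_apply]
      split_ifs with h
      · rw [h1, h2]
      · rfl
  have hreal : ∀ j, (realEig (lam j) ⁻¹' {η}).Finite := by
    intro j
    refine finite_of_row_const (Sum.inl j) (fun k β hβ β' hβ' => ?_)
      fun S' hS' => htop S' (hS'.trans fun β hβ => Or.inl (Or.inl (Set.mem_iUnion.2 ⟨j, hβ⟩)))
    have h1 : lam j β = lam j β' :=
      Complex.ofReal_injective ((show realEig (lam j) β = η from hβ).trans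
        (show realEig (lam j) β' = η from hβ').symm)
    rw [jordanDrift_pow, jordanDrift_pow]
    funext i
    rcases i with i | i
    · simp only [Matrix.fromBlocks_apply₁₁, Matrix.diagonal_apply, h1]
    · rfl
  refine ((Set.finite_iUnion hreal).union (Set.finite_iUnion fun j => ?_)).union
    (Set.finite_iUnion fun j => ?_)
  · have hβ : ∀ β ∈ eigPlus (α j) (ω j) ⁻¹' {η}, α j β = η.re ∧ ω j β = η.im := by
      intro β hβ
      rw [← show eigPlus (α j) (ω j) β = η from hβ]
      simp [eigPlus]
    exact hpair j _ (fun β h => (hβ β h).1)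
      (fun β h β' h' => (hβ β h).2.trans (hβ β' h').2.symm)
      fun β h => Or.inl (Or.inr (Set.mem_iUnion.2 ⟨j, h⟩))
  · have hβ : ∀ β ∈ eigMinus (α j) (ω j) ⁻¹' {η}, α j β = η.re ∧ ω j β = -η.im := by
      intro β hβ
      rw [← show eigMinus (α j) (ω j) β = η from hβ]
      simp [eigMinus]
    exact hpair j _ (fun β h => (hβ β h).1)
      (fun β h β' h' => (hβ β h).2.trans (hβ β' h').2.symm)
      fun β h => Or.inr (Set.mem_iUnion.2 ⟨j, h⟩)

end Jordan

end EnsembleControl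

open EnsembleControl

theorem mainTheorem1 (K : Set ℝ) [CompactSpace K] (r l m : ℕ)
    (lam : Fin r → C(K, ℝ)) (α ω : Fin l → C(K, ℝ))
    (B : C(K, Matrix (Coord r l) (Fin m) ℝ))
    (hclosed : ∀ f ∈ reachableSpan (jordanDrift lam α ω) B,
      mulVecC (jordanDriftStar lam α ω) f ∈ reachableSpan (jordanDrift lam α ω) B) :
    (UniformlyEnsembleControllable (jordanDrift lam α ω) B ↔
      ∀ η ∈ eigenvalueSet lam α ω,
        SubsystemControllable (jordanDrift lam α ω) B (eigenvalueFiber lam α ω η)) ∧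
    ((∀ j, FiniteToOne (realEig (lam j))) →
      (∀ j, FiniteToOne (eigPlus (α j) (ω j))) →
      (∀ j, FiniteToOne (eigMinus (α j) (ω j))) →
      (UniformlyEnsembleControllable (jordanDrift lam α ω) B ↔
        ∀ η ∈ eigenvalueSet lam α ω,
          (ensembleControllabilityMatrix (jordanDrift lam α ω) B
            (eigenvalueFiber lam α ω η)).rank =
              (r + 2 * l) * (eigenvalueFiber lam α ω η).ncard)) := by
  have hpart1 : UniformlyEnsembleControllable (jordanDrift lam α ω) B ↔
      ∀ η ∈ eigenvalueSet lam α ω,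
        SubsystemControllable (jordanDrift lam α ω) B (eigenvalueFiber lam α ω η) := by
    rw [uniformlyEnsembleControllable_iff]
    constructor
    · intro h η _
      have hfin : (eigenvalueFiber lam α ω η).Finite :=
        finite_eigenvalueFiber fun S _ hS => subsystemKrylov_eq_top_of_dense h hS
      exact (subsystemControllable_iff hfin).2 (subsystemKrylov_eq_top_of_dense h hfin)
    · intro h
      refine dense_of_subsystemKrylov_eq_top hclosed fun η hη => ?_
      have hfin : (eigenvalueFiber lam α ω η).Finite :=
        finite_eigenvalueFiber fun S hS hSf =>
          (subsystemControllable_iff hSf).1 ((h η hη).mono hS)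
      exact (subsystemControllable_iff hfin).1 (h η hη)
  refine ⟨hpart1, fun h1 h2 h3 => hpart1.trans (forall₂_congr fun η _ => ?_)⟩
  have hfin : (eigenvalueFiber lam α ω η).Finite :=
    ((Set.finite_iUnion fun j => (h1 j).finite_preimage η).union
      (Set.finite_iUnion fun j => (h2 j).finite_preimage η)).union
      (Set.finite_iUnion fun j => (h3 j).finite_preimage η)
  rw [subsystemControllable_iff hfin, ← rank_ensembleControllabilityMatrix_iff hfin]
  simp
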